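/- **Theorem.** Let $A$ be a finite dimensional algebra over a field $K$; modules are finite dimensional right modules, and $\mathrm{mod}\text{-}A$ is the category of these. Suppose that $A$ is selfinjective and 1-Extsymmetric, i.e. for all modules $X,Y$ one has $\mathrm{Ext}^1_A(X,Y)\neq 0$ if and only if $\mathrm{Ext}^1_A(Y,X)\neq 0$. Let $s$ be the number of isomorphism classes of simple $A$-modules. Write $\mathrm{size}(M)$ for the number of isomorphism classes of indecomposable direct summands of $M$ and $\mathrm{add}(M)$ for the class of direct summands of the $M^n$, $n\ge 1$. In $\mathbb{N}\cup\{\infty\}$ put $$o_1(A)=\sup\{\mathrm{size}(M)\mid M\in \mathrm{mod}\text{-}A,\ \mathrm{Ext}^1_A(X,Y)=0 \text{ for all } X,Y\in \mathrm{add}(M)\},$$ $$\phi_M=\inf\{r\ge 1\mid \mathrm{Ext}^r_A(M,M)\neq 0\}\quad(\inf\emptyset=\infty),$$ $$\Delta_A=\sup\{\phi_M\mid M \text{ a nonprojective generator-cogenerator of } \mathrm{mod}\text{-}A\}.$$ Then $$\Delta_A\le o_1(A)-s+1;$$ in particular $\Delta_A\le o_1(A)+s-2$ if $s\ge 2$.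 Moreover, let $M$ be a nonprojective generator of $\mathrm{mod}\text{-}A$ and $B=\mathrm{End}_A(M)$. Let $\mathrm{domdim}(B)\in\mathbb{N}\cup\{\infty\}$ be the supremum of all $n\ge 0$ such that the first $n$ terms $I_0,\dots,I_{n-1}$ of a minimal injective resolution $0\to B\to I_0\to I_1\to\cdots$ of the right module $B$ are projective. Then $$\mathrm{domdim}(B)\le \Delta_A+1\le o_1(A)-s+2,$$ and $\Delta_A+1\le o_1(A)+s-1$ if $s\ge 2$. -/

import Mathlib

open CategoryTheory

universe u

/-!
All modules below are objects of `ModuleCat.{u} R` for a ring `R : Type u`.  The theorem applies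
these notions to `R = Aᵐᵒᵖ`, that is, to right `A`-modules, where `A` is a finite dimensional
algebra over a field.  Over such an `A` a right module is finite dimensional if and only if it is
finitely generated, so that `mod-A` consists of the `M : ModuleCat Aᵐᵒᵖ` with
`Module.Finite Aᵐᵒᵖ M`.
-/

/-- The number of isomorphism classes of objects with the property `P`. -/
noncomputable def numIsoClasses {C : Type*} [Category C] (P : ObjectProperty C) : ℕ∞ :=
  ENat.card (Quotient (isIsomorphicSetoid P.FullSubcategory))

section Modules

variable {R : Type u} [Ring R]

/-- `N ∈ add(M)`: the module `N` is a direct summand of `Mⁿ` for some `n ≥ 1`. -/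
def InAdd (M N : ModuleCat.{u} R) : Prop :=
  ∃ n : ℕ, 1 ≤ n ∧ Nonempty (Retract N (ModuleCat.of R (Fin n → M)))

/-- `size(M)`: the number of isomorphism classes of indecomposable direct summands of `M`. -/
noncomputable def moduleSize (M : ModuleCat.{u} R) : ℕ∞ :=
  numIsoClasses fun N : ModuleCat.{u} R => Indecomposable N ∧ Nonempty (Retract N M)

/-- `M` is `k`-rigid: `Extⁱ(X, Y) = 0` for all `X, Y ∈ add(M)` and `i = 1, …, k`. -/
def IsRigid (k : ℕ) (M : ModuleCat.{u} R) : Prop :=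
  ∀ X Y : ModuleCat.{u} R, InAdd M X → InAdd M Y →
    ∀ i : ℕ, 1 ≤ i → i ≤ k → Subsingleton (Abelian.Ext X Y i)

/-- `M` is a generator of the category of finitely generated modules: each of its objects is a
quotient of some `Mⁿ`. -/
def IsGen (M : ModuleCat.{u} R) : Prop :=
  ∀ N : ModuleCat.{u} R, Module.Finite R N →
    ∃ (n : ℕ) (f : (Fin n → M) →ₗ[R] N), Function.Surjective f

/-- `M` is a cogenerator of the category of finitely generated modules: each of its objects is a
submodule of some `Mⁿ`. -/
def IsCogen (M : ModuleCat.{u} R) : Prop :=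
  ∀ N : ModuleCat.{u} R, Module.Finite R N →
    ∃ (n : ℕ) (f : N →ₗ[R] (Fin n → M)), Function.Injective f

/-- `φ_M = inf {r ≥ 1 | Extʳ(M, M) ≠ 0}`, where the infimum of the empty set is `∞`. -/
noncomputable def phi (M : ModuleCat.{u} R) : ℕ∞ :=
  ⨅ r ∈ {r : ℕ | 1 ≤ r ∧ Nontrivial (Abelian.Ext M M r)}, (r : ℕ∞)

/-- An injective resolution `0 → M → I⁰ → I¹ → ⋯` is minimal if the kernel of every
`dⁿ : Iⁿ → Iⁿ⁺¹` (which is the image of the map that comes into `Iⁿ`) is an essential submodule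
of `Iⁿ`. -/
def IsMinimalResolution {M : ModuleCat.{u} R} (I : InjectiveResolution M) : Prop :=
  ∀ (n : ℕ) (U : Submodule R (I.cocomplex.X n)),
    U ⊓ LinearMap.ker (I.cocomplex.d n (n + 1)).hom = ⊥ → U = ⊥

/-- The dominant dimension of `M`: the supremum of the `n` such that the first `n` terms
`I⁰, …, Iⁿ⁻¹` of a minimal injective resolution of `M` are projective.  (Minimal injective
resolutions are unique up to isomorphism.) -/
noncomputable def domDim (M : ModuleCat.{u} R) : ℕ∞ :=
  ⨆ n ∈ {n : ℕ | ∃ I : InjectiveResolution M, IsMinimalResolution I ∧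
    ∀ i < n, Module.Projective R (I.cocomplex.X i)}, (n : ℕ∞)

end Modules

section Algebras

variable (A : Type u) [Ring A]

/-- The number of simple right `A`-modules up to isomorphism. -/
noncomputable def numSimples : ℕ∞ :=
  numIsoClasses fun S : ModuleCat.{u} Aᵐᵒᵖ => IsSimpleModule Aᵐᵒᵖ S

/-- `o_k(A)`: the supremum of `size(M)` over all `k`-rigid modules `M` in `mod-A`. -/
noncomputable def rigidBound (k : ℕ) : ℕ∞ :=
  ⨆ M ∈ {M : ModuleCat.{u} Aᵐᵒᵖ | Module.Finite Aᵐᵒᵖ M ∧ IsRigid k M}, moduleSize M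

/-- `Δ_A`: the supremum of `φ_M` over all nonprojective generator-cogenerators `M` of `mod-A`. -/
noncomputable def Delta : ℕ∞ :=
  ⨆ M ∈ {M : ModuleCat.{u} Aᵐᵒᵖ | Module.Finite Aᵐᵒᵖ M ∧ ¬ Module.Projective Aᵐᵒᵖ M ∧
    IsGen M ∧ IsCogen M}, phi M

/-- The dominant dimension of a ring: that of its right regular module. -/
noncomputable def ringDomDim : ℕ∞ :=
  domDim (ModuleCat.of Aᵐᵒᵖ A)

/-- `A` is selfinjective and, for all `X, Y` in `mod-A`, `Ext¹(X, Y) ≠ 0` if and only if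
`Ext¹(Y, X) ≠ 0`. -/
structure IsOneExtsymmetric : Prop where
  selfinjective : Module.Injective Aᵐᵒᵖ A
  ext_symm : ∀ X Y : ModuleCat.{u} Aᵐᵒᵖ, Module.Finite Aᵐᵒᵖ X → Module.Finite Aᵐᵒᵖ Y →
    (Nontrivial (Abelian.Ext X Y 1) ↔ Nontrivial (Abelian.Ext Y X 1))

end Algebras

/-! Let `M` be finitely generated and nonprojective with `Extᵏ(M, M) = 0` for `1 ≤ k ≤ r`, and let
`Ωⁱ` be its syzygies. Free modules of finite rank are projective and injective, so dimension
shifting in both arguments turns `Extⁱ⁻ʲ⁺¹(M, M) = 0` into `Ext¹(Ωⁱ, Ωʲ) = 0` for `j ≤ i < r`;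
Ext-symmetry gives the opposite order. Hence `A ⊕ Ω⁰ ⊕ ⋯ ⊕ Ωʳ⁻¹` is rigid. It has `s` indecomposable
projective summands, one per simple module, and each `Ωⁱ` contributes a nonprojective indecomposable
one. These are pairwise nonisomorphic, since a common summand of `Ωʲ⁺¹` and `Ωⁱ` is projective as
soon as `Ext¹(Ωʲ, Ωⁱ) = 0` (`projective_of_common_retract`). So `s + r ≤ o₁(A)`
(`exists_isRigid_of_subsingleton_ext`), which bounds `Δ_A`.

For `B = End(M)`, the functor `Hom(M, -)` is fully faithful with an exact left adjoint
(Gabriel–Popescu). The adjoint carries the projective-injective start of a resolution of `B` to the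
start of an injective resolution of `M`, which yields Müller's bound `domdim B ≤ φ_M + 1`
(`domDim_end_le_phi`). Generators are cogenerators here (`IsGen.isCogen`), so `φ_M ≤ Δ_A`. -/

open Limits Abelian

/-! ### Dimension shifting and extension of maps through `Ext`. -/

section ExtGeneral

universe w v v'

variable {C : Type v} [Category.{v'} C] [Abelian C] [HasExt.{w} C]

lemma subsingleton_ext_of_retract_left {X X' Y : C} (h : Retract X' X) {n : ℕ}
    (hX : Subsingleton (Ext X Y n)) : Subsingleton (Ext X' Y n) := by
  refine subsingleton_of_forall_eq 0 fun x => ?_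
  rw [← Ext.mk₀_id_comp x, ← h.retract, ← Ext.mk₀_comp_mk₀, Ext.comp_assoc_of_second_deg_zero,
    Subsingleton.elim ((Ext.mk₀ h.r).comp x (zero_add n)) 0, Ext.comp_zero]

lemma subsingleton_ext_of_retract_right {X Y Y' : C} (h : Retract Y' Y) {n : ℕ}
    (hY : Subsingleton (Ext X Y n)) : Subsingleton (Ext X Y' n) := by
  refine subsingleton_of_forall_eq 0 fun x => ?_
  rw [← Ext.comp_mk₀_id x, ← h.retract, ← Ext.mk₀_comp_mk₀,
    ← Ext.comp_assoc_of_third_deg_zero,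
    Subsingleton.elim (x.comp (Ext.mk₀ h.i) (add_zero n)) 0, Ext.zero_comp]

variable {S : ShortComplex C} (hS : S.ShortExact)

include hS

lemma ShortExact.subsingleton_ext_succ_of_injective (hI : Injective S.X₂) {X : C} {n : ℕ}
    (h : Subsingleton (Ext X S.X₃ n)) : Subsingleton (Ext X S.X₁ (n + 1)) := by
  refine subsingleton_of_forall_eq 0 fun x => ?_
  obtain ⟨y, rfl⟩ := Ext.covariant_sequence_exact₁ X hS x (Ext.eq_zero_of_injective _) rfl
  rw [Subsingleton.elim y 0, Ext.zero_comp]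

lemma ShortExact.subsingleton_ext_of_projective (hP : Projective S.X₂) {Y : C} {n : ℕ}
    (h : Subsingleton (Ext S.X₃ Y (n + 2))) : Subsingleton (Ext S.X₁ Y (n + 1)) := by
  refine subsingleton_of_forall_eq 0 fun x => ?_
  obtain ⟨y, rfl⟩ := Ext.contravariant_sequence_exact₁ hS Y x (n₁ := n + 2) (by omega)
    (Subsingleton.elim _ _)
  rw [Ext.eq_zero_of_projective y, Ext.comp_zero]

lemma ShortExact.exists_extension_of_subsingleton_ext {Y : C}
    (h : Subsingleton (Ext S.X₃ Y 1)) (g : S.X₁ ⟶ Y) : ∃ g' : S.X₂ ⟶ Y, S.f ≫ g' = g := by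
  obtain ⟨y, hy⟩ := Ext.contravariant_sequence_exact₁ hS Y (Ext.mk₀ g) (n₁ := 1) rfl
    (Subsingleton.elim _ _)
  obtain ⟨g', rfl⟩ := (Ext.mk₀_bijective _ _).2 y
  refine ⟨g', (Ext.mk₀_bijective _ _).1 ?_⟩
  rw [← hy, Ext.mk₀_comp_mk₀]

lemma ShortExact.subsingleton_ext_one_of_lift (hI : Injective S.X₂) {X : C}
    (h : ∀ g : X ⟶ S.X₃, ∃ g' : X ⟶ S.X₂, g' ≫ S.g = g) : Subsingleton (Ext X S.X₁ 1) := by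
  refine subsingleton_of_forall_eq 0 fun x => ?_
  obtain ⟨y, rfl⟩ := Ext.covariant_sequence_exact₁ X hS x (n₀ := 0) (Ext.eq_zero_of_injective _) rfl
  obtain ⟨g, rfl⟩ := (Ext.mk₀_bijective _ _).2 y
  obtain ⟨g', rfl⟩ := h g
  rw [← Ext.mk₀_comp_mk₀, Ext.comp_assoc_of_second_deg_zero, hS.comp_extClass, Ext.comp_zero]

end ExtGeneral

/-! ### Müller's theorem for a reflective adjunction with exact left adjoint. -/

section Mueller

universe w v₁ v₂ u₁ u₂

variable {C : Type u₁} [Category.{v₁} C] {D : Type u₂} [Category.{v₂} D]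
  {F : D ⥤ C} {H : C ⥤ D} (adj : F ⊣ H)

/-- Injectivity splits the unit by some `r`. As `F` inverts the unit, it sends the idempotent `r ≫
η` to the identity; this idempotent is an endomorphism of an object in the image of the fully
faithful `H`, so it is itself the identity. -/
lemma isIso_unit_of_injective_of_mono [H.Full] [H.Faithful] {I : D}
    [Injective I] [Mono (adj.unit.app I)] : IsIso (adj.unit.app I) := by
  let r : H.obj (F.obj I) ⟶ I := Injective.factorThru (𝟙 I) (adj.unit.app I)
  have hr : adj.unit.app I ≫ r = 𝟙 I := Injective.comp_factorThru _ _
  refine ⟨r, hr, ?_⟩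
  have h1 : IsIso (F.map (adj.unit.app I)) :=
    ⟨adj.counit.app _, by simp, by
      rw [← cancel_mono (adj.counit.app (F.obj I))]
      simp⟩
  have h2 : F.map r ≫ F.map (adj.unit.app I) = 𝟙 _ := by
    rw [← cancel_epi (F.map (adj.unit.app I)), ← Category.assoc, ← F.map_comp, hr]
    simp
  obtain ⟨t, ht⟩ := H.map_surjective (r ≫ adj.unit.app I)
  rw [← ht]
  refine (congrArg H.map ?_).trans (H.map_id _)
  have h3 : F.map (H.map t) = 𝟙 _ := by
    rw [ht, F.map_comp, h2]
  have := adj.counit_naturality t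
  rw [h3, Category.id_comp] at this
  rw [← cancel_epi (adj.counit.app _), ← this]
  exact (Category.comp_id _).symm

lemma injective_obj_of_isIso_unit [H.Full] [H.Faithful] {I : D} [Injective I]
    [IsIso (adj.unit.app I)] : Injective (F.obj I) :=
  adj.injective_of_map_injective _ (Injective.of_iso (asIso (adj.unit.app I)) inferInstance)

variable [Abelian C] [Abelian D]

/-- The short complex `0 → ker dⁿ → Iⁿ → ker dⁿ⁺¹ → 0` of a cochain complex `I`. -/
noncomputable def cocycleShortComplex (I : CochainComplex D ℕ) (n : ℕ) : ShortComplex D :=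
  ShortComplex.mk (kernel.ι (I.d n (n + 1)))
    (kernel.lift (I.d (n + 1) (n + 2)) (I.d n (n + 1)) (I.d_comp_d _ _ _)) (by
      rw [← cancel_mono (kernel.ι _)]; simp)

lemma cocycleShortComplex_shortExact {B : D} (I : InjectiveResolution B) (n : ℕ) :
    (cocycleShortComplex I.cocomplex n).ShortExact := by
  have hm : Mono (cocycleShortComplex I.cocomplex n).f := by
    dsimp [cocycleShortComplex]; infer_instance
  have he : Epi (cocycleShortComplex I.cocomplex n).g := by
    have := (I.exact_succ n).epi_kernelLift
    exact this
  refine ⟨?_⟩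
  refine ShortComplex.exact_of_f_is_kernel _ ?_
  refine KernelFork.IsLimit.ofι' _ _ fun {A} k hk => ⟨kernel.lift _ k ?_, ?_⟩
  · have := hk =≫ kernel.ι (I.cocomplex.d (n + 1) (n + 2))
    refine Eq.trans (congrArg (k ≫ ·) ?_) ((Category.assoc _ _ _).symm.trans (this.trans zero_comp))
    exact (kernel.lift_ι _ _ _).symm
  · exact kernel.lift_ι _ _ _

/-- The map `g ≫ F.map i` comes from a map `b : B ⟶ I` because the unit at `I` is invertible, and `b
≫ d = 0` can be tested after the monic unit at `J`. So `b` factors through `Z`, and projectivity of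
`B` lifts it to `I'`. -/
lemma exists_lift_of_isIso_unit [PreservesFiniteLimits F] {B Z I I' J : D} [Projective B]
    (p : I' ⟶ Z) (hp : Epi p) (i : Z ⟶ I) (hi : Mono i) (d : I ⟶ J) [IsIso (adj.unit.app I)]
    [Mono (adj.unit.app J)] (hd : ∀ b : B ⟶ I, b ≫ d = 0 → ∃ b', b' ≫ i = b) (hid : i ≫ d = 0)
    (g : F.obj B ⟶ F.obj Z) : ∃ g' : F.obj B ⟶ F.obj I', g' ≫ F.map p = g := by
  have : F.Additive := Functor.additive_of_preserves_binary_products F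
  have := adj.right_adjoint_additive
  let b : B ⟶ I := adj.homEquiv _ _ (g ≫ F.map i) ≫ inv (adj.unit.app I)
  have hb : F.map b = g ≫ F.map i := by
    apply (adj.homEquiv _ _).injective
    rw [adj.homEquiv_unit, adj.unit_naturality]
    simp [b]
  obtain ⟨b', hb'⟩ := hd b (by
    have h := adj.unit_naturality (b ≫ d)
    rw [F.map_comp, hb, Category.assoc, ← F.map_comp, hid, F.map_zero, comp_zero, H.map_zero,
      comp_zero] at h
    rw [← cancel_mono (adj.unit.app J), zero_comp]
    exact h.symm)
  refine ⟨F.map (Projective.factorThru b' p), ?_⟩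
  rw [← F.map_comp, Projective.factorThru_comp, ← cancel_mono (F.map i), ← hb, ← F.map_comp, hb']

variable [HasExt.{w} C]

/-- Hom-tensor form of Müller's theorem on the dominant dimension of an endomorphism ring. -/
theorem subsingleton_ext_of_projective_terms [H.Full] [H.Faithful] [PreservesFiniteLimits F]
    (hmono : ∀ P : D, Projective P → Mono (adj.unit.app P)) {B : D} [Projective B]
    (I : InjectiveResolution B) {n : ℕ} (hI : ∀ i < n, Projective (I.cocomplex.X i)) (i : ℕ)
    (hi : i + 3 ≤ n) : Subsingleton (Ext (F.obj B) (F.obj B) (i + 1)) := by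
  have := adj.leftAdjoint_preservesColimits
  have : F.Additive := Functor.additive_of_preserves_binary_products F
  have hS (j : ℕ) := (cocycleShortComplex_shortExact I j).map_of_exact F
  have hiso (j : ℕ) (hj : j < n) : IsIso (adj.unit.app (I.cocomplex.X j)) := by
    have := hmono _ (hI j hj)
    exact isIso_unit_of_injective_of_mono adj
  have hinj (j : ℕ) (hj : j < n) : Injective (F.obj (I.cocomplex.X j)) := by
    have := hiso j hj
    exact injective_obj_of_isIso_unit adj
  -- With `Zʲ = ker dʲ`, the injective terms `F Iʲ` shift `Extᵏ⁺¹(F B, F Zʲ)` to `Ext¹(F B, F Zⁱ)`.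
  -- The base case uses the terms of index `i`, `i + 1` and `i + 2`, whence `i + 3 ≤ n`.
  have key (k : ℕ) : ∀ j, j + k = i →
      Subsingleton (Ext (F.obj B) (F.obj (kernel (I.cocomplex.d j (j + 1)))) (k + 1)) := by
    induction k with
    | zero =>
      rintro j rfl
      refine ShortExact.subsingleton_ext_one_of_lift (hS j) (hinj j (by omega)) fun g => ?_
      have := hiso (j + 1) (by omega)
      have := hmono _ (hI (j + 2) (by omega))
      exact exists_lift_of_isIso_unit adj (cocycleShortComplex I.cocomplex j).g
        (cocycleShortComplex_shortExact I j).epi_g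
        (kernel.ι (I.cocomplex.d (j + 1) (j + 2))) (equalizer.ι_mono) (I.cocomplex.d (j + 1) (j + 2))
        (fun b hb => ⟨kernel.lift _ b hb, kernel.lift_ι _ _ _⟩) (kernel.condition _) g
    | succ k ih =>
      intro j hj
      exact ShortExact.subsingleton_ext_succ_of_injective (hS j) (hinj j (by omega))
        (ih (j + 1) (by omega))
  have e : B ≅ kernel (I.cocomplex.d 0 1) :=
    I.isLimitKernelFork.conePointUniqueUpToIso (limit.isLimit _)
  exact subsingleton_ext_of_retract_right (F.mapIso e).retract (key i 0 (by omega))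

end Mueller

/-! ### Counting isomorphism classes. -/

section IsoClasses

universe w

variable {C : Type w} [Category C] {P : ObjectProperty C}

lemma card_le_numIsoClasses {ι : Type*} (Y : ι → C) (hY : ∀ i, P (Y i))
    (h : ∀ i j, Nonempty (Y i ≅ Y j) → i = j) : ENat.card ι ≤ numIsoClasses P := by
  refine ENat.card_le_card_of_injective (f := fun i =>
    (Quotient.mk (isIsomorphicSetoid P.FullSubcategory) ⟨Y i, hY i⟩)) fun i j hij => h i j ?_
  obtain ⟨e⟩ := Quotient.exact hij
  exact ⟨P.ι.mapIso e⟩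

variable (P) in
lemma exists_representatives : ∃ (ι : Type w) (Y : ι → C), ENat.card ι = numIsoClasses P ∧
    (∀ i, P (Y i)) ∧ (∀ i j, Nonempty (Y i ≅ Y j) → i = j) ∧
      ∀ X, P X → ∃ i, Nonempty (X ≅ Y i) := by
  let ι := Quotient (isIsomorphicSetoid P.FullSubcategory)
  let Z (i : ι) : P.FullSubcategory := Quotient.out i
  refine ⟨ι, fun i => (Z i).obj, rfl, fun i => (Z i).property, fun i j ⟨e⟩ => ?_, fun X hX => ⟨Quotient.mk _ ⟨X, hX⟩, ?_⟩⟩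
  · rw [← Quotient.out_eq i, ← Quotient.out_eq j]
    exact Quotient.sound ⟨P.fullyFaithfulι.preimageIso e⟩
  · obtain ⟨e⟩ := Quotient.mk_out (s := isIsomorphicSetoid P.FullSubcategory) ⟨X, hX⟩
    exact ⟨(P.ι.mapIso e).symm⟩

end IsoClasses

/-! ### Fitting's lemma and indecomposable projectives and injectives of finite length. -/

section Indecomposable

variable {R : Type u} [Ring R]

lemma indecomposable_submodule {Y : ModuleCat.{u} R} (hY : Indecomposable Y) {p q : Submodule R Y}
    (h : IsCompl p q) : p = ⊥ ∨ q = ⊥ := by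
  let e : Y ≅ ModuleCat.of R p ⊞ ModuleCat.of R q :=
    (Submodule.prodEquivOfIsCompl p q h).symm.toModuleIso ≪≫
      (ModuleCat.biprodIsoProd (ModuleCat.of R p) (ModuleCat.of R q)).symm
  refine (hY.2 _ _ e).imp (fun h => ?_) fun h => ?_
  · exact Submodule.subsingleton_iff_eq_bot.1 (ModuleCat.isZero_iff_subsingleton.1 h)
  · exact Submodule.subsingleton_iff_eq_bot.1 (ModuleCat.isZero_iff_subsingleton.1 h)

/-- Fitting's lemma. -/
lemma isNilpotent_or_bijective_of_indecomposable {Y : ModuleCat.{u} R} (hY : Indecomposable Y)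
    [IsArtinian R Y] [IsNoetherian R Y] (f : Module.End R Y) :
    (∃ n : ℕ, f ^ n = 0) ∨ Function.Bijective f := by
  obtain ⟨n, hn, hn1⟩ := (f.eventually_isCompl_ker_pow_range_pow.and
    (Filter.eventually_ge_atTop 1)).exists
  rcases indecomposable_submodule hY hn with h | h
  · right
    refine IsArtinian.bijective_of_injective_endomorphism f ?_
    have h1 : Function.Injective (f ^ n) := LinearMap.ker_eq_bot.1 h
    obtain ⟨m, rfl⟩ : ∃ m, n = m + 1 := ⟨n - 1, by omega⟩
    rw [pow_succ] at h1
    exact Function.Injective.of_comp h1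
  · exact Or.inl ⟨n, LinearMap.range_eq_bot.1 h⟩

/-- A property of finite length modules that passes to a summand of each decomposition passes to an
indecomposable summand. -/
lemma exists_indecomposable_retract (Q : ModuleCat.{u} R → Prop)
    (h0 : ∀ X, Q X → ¬ IsZero X)
    (hadd : ∀ N X Y : ModuleCat.{u} R, (N ≅ X ⊞ Y) → Q N → Q X ∨ Q Y)
    (N : ModuleCat.{u} R) [IsArtinian R N] [IsNoetherian R N] (hN : Q N) :
    ∃ Y : ModuleCat.{u} R, Indecomposable Y ∧ Nonempty (Retract Y N) ∧ Q Y := by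
  obtain ⟨n, hn⟩ : ∃ n : ℕ, Module.length R N = n :=
    ⟨_, (ENat.natCast_toNat Module.length_ne_top).symm⟩
  induction n using Nat.strong_induction_on generalizing N with
  | _ n ih =>
    by_cases hi : Indecomposable N
    · exact ⟨N, hi, ⟨Retract.refl N⟩, hN⟩
    have : ∃ X Y : ModuleCat.{u} R, Nonempty (N ≅ X ⊞ Y) ∧ ¬ IsZero X ∧ ¬ IsZero Y := by
      by_contra! hc
      exact hi ⟨h0 N hN, fun X Y e => or_iff_not_imp_left.2 fun hX => hc X Y ⟨e⟩ hX⟩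
    obtain ⟨X, Y, ⟨e⟩, hX, hY⟩ := this
    have e' := (e ≪≫ ModuleCat.biprodIsoProd X Y).toLinearEquiv
    have hlen : Module.length R N = Module.length R X + Module.length R Y :=
      e'.length_eq.trans (Module.length_prod ..)
    rw [ModuleCat.isZero_iff_subsingleton, not_subsingleton_iff_nontrivial] at hX hY
    have hX' : 0 < Module.length R X := Module.length_pos
    have hY' : 0 < Module.length R Y := Module.length_pos
    have aux (Z : ModuleCat.{u} R) (hZ : Q Z) (r : Retract Z N)
        (hlt : ∀ k : ℕ, Module.length R Z = k → k < n) :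
        ∃ Y : ModuleCat.{u} R, Indecomposable Y ∧ Nonempty (Retract Y N) ∧ Q Y := by
      have hinj : Function.Injective r.i.hom := by
        refine Function.LeftInverse.injective (g := r.r.hom) fun z => ?_
        exact congrArg (fun f => f.hom z) r.retract
      have : IsArtinian R Z := isArtinian_of_injective _ hinj
      have : IsNoetherian R Z := isNoetherian_of_injective _ hinj
      obtain ⟨k, hk⟩ : ∃ k : ℕ, Module.length R Z = k :=
        ⟨_, (ENat.natCast_toNat Module.length_ne_top).symm⟩
      obtain ⟨W, hW, ⟨w⟩, hQ⟩ := ih k (hlt k hk) Z hZ hk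
      exact ⟨W, hW, ⟨w.trans r⟩, hQ⟩
    rcases hadd N X Y e hN with h | h
    · refine aux X h (Retract.trans ⟨biprod.inl, biprod.fst, by simp⟩ e.symm.retract) fun k hk => ?_
      rw [hk, hn] at hlen
      have h1 : (k : ℕ∞) + 1 ≤ n :=
        hlen ▸ add_le_add le_rfl (Order.one_le_iff_pos.2 hY')
      exact_mod_cast h1
    · refine aux Y h (Retract.trans ⟨biprod.inr, biprod.snd, by simp⟩ e.symm.retract) fun k hk => ?_
      rw [hk, hn] at hlen
      have h1 : (k : ℕ∞) + 1 ≤ n :=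
        hlen ▸ add_comm (k : ℕ∞) 1 ▸ add_le_add (Order.one_le_iff_pos.2 hX') le_rfl
      exact_mod_cast h1

/-- An indecomposable projective module of finite length has at most one simple quotient. -/
lemma nonempty_iso_of_indecomposable_of_surjective {P S S' : ModuleCat.{u} R} (hP : Indecomposable P)
    [Module.Projective R P] [IsArtinian R P] [IsNoetherian R P] [IsSimpleModule R S]
    [IsSimpleModule R S'] (f : P →ₗ[R] S) (hf : Function.Surjective f) (g : P →ₗ[R] S')
    (hg : Function.Surjective g) : Nonempty (S ≅ S') := by
  have hfm : IsCoatom (LinearMap.ker f) := LinearMap.isCoatom_ker_of_surjective hf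
  have hgm : IsCoatom (LinearMap.ker g) := LinearMap.isCoatom_ker_of_surjective hg
  by_cases hk : LinearMap.ker f = LinearMap.ker g
  · exact ⟨((f.quotKerEquivOfSurjective hf).symm ≪≫ₗ (Submodule.quotEquivOfEq _ _ hk) ≪≫ₗ
      (g.quotKerEquivOfSurjective hg)).toModuleIso⟩
  exfalso
  have hsurj : Function.Surjective (f ∘ₗ (LinearMap.ker g).subtype) := by
    refine (LinearMap.surjective_or_eq_zero _).resolve_right fun h0 => hk ?_
    have hle : LinearMap.ker g ≤ LinearMap.ker f := fun x hx => by
      simpa using LinearMap.congr_fun h0 ⟨x, hx⟩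
    exact ((hgm.le_iff.1 hle).resolve_left hfm.1)
  obtain ⟨h, hh⟩ := Module.projective_lifting_property (f ∘ₗ (LinearMap.ker g).subtype) f hsurj
  let k : Module.End R P := (LinearMap.ker g).subtype ∘ₗ h
  have hfk : f ∘ₗ k = f := hh
  -- Since `f ∘ k = f ≠ 0`, `k` is not nilpotent; since its image lies in the proper submodule `ker
  -- g`, it is not bijective.
  rcases isNilpotent_or_bijective_of_indecomposable hP k with ⟨n, hn⟩ | hb
  · have hpow : ∀ m : ℕ, f ∘ₗ (k ^ m) = f := by
      intro m
      induction m with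
      | zero => rfl
      | succ m ih => rw [pow_succ, Module.End.mul_eq_comp, ← LinearMap.comp_assoc, ih, hfk]
    have h0 : f = 0 := by rw [← hpow n, hn, LinearMap.comp_zero]
    subst h0
    exact hfm.1 LinearMap.ker_zero
  · refine hgm.1 (eq_top_iff.2 fun x _ => ?_)
    obtain ⟨y, rfl⟩ := hb.2 x
    exact (h y).2

/-- An indecomposable injective module of finite length is determined by each of its simple
submodules. -/
lemma nonempty_iso_of_indecomposable_of_injective {P P' T : ModuleCat.{u} R} (hP : Indecomposable P)
    (hP' : Indecomposable P') [Injective P] [Injective P'] [IsArtinian R P]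
    [IsNoetherian R P] [IsArtinian R P'] [IsNoetherian R P'] (hT : ¬ IsZero T) (i : T ⟶ P)
    (j : T ⟶ P') [Mono i] [Mono j] : Nonempty (P ≅ P') := by
  let a : P ⟶ P' := Injective.factorThru j i
  let b : P' ⟶ P := Injective.factorThru i j
  have ha : i ≫ a = j := Injective.comp_factorThru _ _
  have hb : j ≫ b = i := Injective.comp_factorThru _ _
  -- An endomorphism that fixes the nonzero `T` pointwise is not nilpotent, hence bijective by
  -- Fitting; this applies to `a ≫ b` and `b ≫ a`.
  have aux {Z : ModuleCat.{u} R} (hZ : Indecomposable Z) (_ : IsArtinian R Z)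
      (_ : IsNoetherian R Z) (t : T ⟶ Z) (_ : Mono t) (c : Z ⟶ Z) (hc : t ≫ c = t) :
      Function.Bijective c.hom := by
    refine (isNilpotent_or_bijective_of_indecomposable hZ c.hom).resolve_left ?_
    rintro ⟨n, hn⟩
    have ht : ∀ m : ℕ, ∀ x : T, (c.hom ^ m : Module.End R Z) (t.hom x) = t.hom x := by
      intro m
      induction m with
      | zero => intro x; rfl
      | succ m ih =>
        intro x
        rw [pow_succ, Module.End.mul_apply]
        have : c.hom (t.hom x) = t.hom x := congrArg (fun f => f.hom x) hc
        rw [this, ih]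
    refine hT (ModuleCat.isZero_iff_subsingleton.2 ⟨fun x y => ?_⟩)
    refine (ModuleCat.mono_iff_injective t).1 ‹_› ?_
    have hx := ht n x
    have hy := ht n y
    rw [hn] at hx hy
    exact hx.symm.trans hy
  have h1 := aux hP ‹_› ‹_› i ‹_› (a ≫ b) (by rw [← Category.assoc, ha, hb])
  have h2 := aux hP' ‹_› ‹_› j ‹_› (b ≫ a) (by rw [← Category.assoc, hb, ha])
  rw [ModuleCat.hom_comp, LinearMap.coe_comp] at h1 h2
  exact ⟨(LinearEquiv.ofBijective a.hom
    ⟨Function.Injective.of_comp h1.1, Function.Surjective.of_comp h2.2⟩).toModuleIso⟩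

end Indecomposable

/-! ### Generators are cogenerators over an artinian selfinjective ring. -/

section SelfInjective

variable {R : Type u} [Ring R]

lemma isArtinian_of_retract {X Y : ModuleCat.{u} R} (r : Retract X Y) [IsArtinian R Y] :
    IsArtinian R X :=
  isArtinian_of_injective r.i.hom
    (Function.LeftInverse.injective (g := r.r.hom) fun z => congrArg (fun f => f.hom z) r.retract)

lemma isNoetherian_of_retract {X Y : ModuleCat.{u} R} (r : Retract X Y) [IsNoetherian R Y] :
    IsNoetherian R X :=
  isNoetherian_of_injective r.i.hom
    (Function.LeftInverse.injective (g := r.r.hom) fun z => congrArg (fun f => f.hom z) r.retract)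

lemma projective_of_retract {X Y : ModuleCat.{u} R} (r : Retract X Y) [Module.Projective R Y] :
    Module.Projective R X :=
  Module.Projective.of_split r.i.hom r.r.hom
    (LinearMap.ext fun z => congrArg (fun f => f.hom z) r.retract)

lemma injective_of_retract {X Y : ModuleCat.{u} R} (r : Retract X Y) [Injective Y] :
    Injective X :=
  ⟨fun g f _ => ⟨Injective.factorThru (g ≫ r.i) f ≫ r.r, by
    rw [← Category.assoc, Injective.comp_factorThru, Category.assoc, r.retract, Category.comp_id]⟩⟩

/-- A cover of a simple module by an indecomposable summand of the regular module. -/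
lemma exists_indecomposable_cover [IsArtinianRing R] (S : ModuleCat.{u} R) [IsSimpleModule R S] :
    ∃ P : ModuleCat.{u} R, Indecomposable P ∧ Nonempty (Retract P (ModuleCat.of R R)) ∧
      ∃ f : P →ₗ[R] S, Function.Surjective f := by
  have : Nontrivial S := IsSimpleModule.nontrivial R S
  obtain ⟨x, hx⟩ := exists_ne (0 : S)
  have : IsArtinian R (ModuleCat.of R R) := inferInstanceAs (IsArtinian R R)
  have : IsNoetherian R (ModuleCat.of R R) := inferInstanceAs (IsNoetherian R R)
  obtain ⟨P, hP, hr, f, hf⟩ := exists_indecomposable_retract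
    (fun P : ModuleCat.{u} R => ∃ f : P ⟶ S, f ≠ 0)
    (fun X ⟨f, hf⟩ h => hf (h.eq_of_src _ _))
    (fun N X Y e ⟨f, hf⟩ => by
      by_contra! hc
      have h1 := hc.1 (biprod.inl ≫ e.inv ≫ f)
      have h2 := hc.2 (biprod.inr ≫ e.inv ≫ f)
      refine hf ?_
      rw [← cancel_epi e.inv]
      refine biprod.hom_ext' _ _ ?_ ?_
      · rw [h1]; simp
      · rw [h2]; simp)
    (ModuleCat.of R R) ⟨ModuleCat.ofHom (LinearMap.toSpanSingleton R S x), fun h => hx (by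
      simpa using congrArg (fun f => f.hom (1 : R)) h)⟩
  refine ⟨P, hP, hr, f.hom, (LinearMap.surjective_or_eq_zero _).resolve_right fun h => hf ?_⟩
  ext1
  exact h

lemma exists_simple_submodule (P : ModuleCat.{u} R) [IsArtinian R P] (hP : ¬ IsZero P) :
    ∃ (T : ModuleCat.{u} R) (i : T ⟶ P), IsSimpleModule R T ∧ Mono i := by
  rw [ModuleCat.isZero_iff_subsingleton, not_subsingleton_iff_nontrivial] at hP
  obtain ⟨T, hT⟩ := IsAtomic.exists_atom (Submodule R P)
  exact ⟨ModuleCat.of R T, ModuleCat.ofHom T.subtype, isSimpleModule_iff_isAtom.2 hT,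
    (ModuleCat.mono_iff_injective _).2 T.subtype_injective⟩

lemma not_isZero_of_isSimpleModule {T : ModuleCat.{u} R} (hT : IsSimpleModule R T) :
    ¬ IsZero T := by
  rw [ModuleCat.isZero_iff_subsingleton, not_subsingleton_iff_nontrivial]
  exact IsSimpleModule.nontrivial R T

variable [IsArtinianRing R] [hR : Module.Injective R R] {s : ℕ}
  (hs : numIsoClasses (fun S : ModuleCat.{u} R => IsSimpleModule R S) = s)

include hs

/-- Over an artinian selfinjective ring, every simple module embeds into the regular module. -/
lemma exists_injective_of_isSimpleModule (S : ModuleCat.{u} R) (hS : IsSimpleModule R S) :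
    ∃ f : S →ₗ[R] R, Function.Injective f := by
  obtain ⟨ι, Y, hcard, hY, hinj, hsurj⟩ :=
    exists_representatives (fun S : ModuleCat.{u} R => IsSimpleModule R S)
  have : Finite ι := by
    rw [hs] at hcard
    exact ENat.card_lt_top.1 (hcard ▸ ENat.natCast_lt_top s)
  have : IsArtinian R (ModuleCat.of R R) := inferInstanceAs (IsArtinian R R)
  have : IsNoetherian R (ModuleCat.of R R) := inferInstanceAs (IsNoetherian R R)
  have : Injective (ModuleCat.of R R) := Module.injective_object_of_injective_module R R
  choose P hP hr f hf using fun i => @exists_indecomposable_cover R _ _ (Y i) (hY i)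
  have hart (i : ι) : IsArtinian R (P i) := isArtinian_of_retract (hr i).some
  have hnoe (i : ι) : IsNoetherian R (P i) := isNoetherian_of_retract (hr i).some
  have hpro (i : ι) : Module.Projective R (P i) := projective_of_retract (hr i).some
  have hIn (i : ι) : Injective (P i) := injective_of_retract (hr i).some
  choose T t hT ht using fun i => exists_simple_submodule (P i) (hP i).1
  choose σ hσ using fun i => hsurj (T i) (hT i)
  -- Nakayama permutation: sending a simple module to a simple submodule of its indecomposable
  -- projective cover is injective on the finite set of classes, hence surjective. So every simple
  -- module occurs inside the regular module.
  have hσi : Function.Injective σ := fun i j hij => by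
    obtain ⟨e⟩ := hσ i
    obtain ⟨e'⟩ := hσ j
    rw [← hij] at e'
    have := hY i
    have := hY j
    obtain ⟨p⟩ := nonempty_iso_of_indecomposable_of_injective (hP i) (hP j)
      (not_isZero_of_isSimpleModule (hT i)) (t i) ((e ≪≫ e'.symm).hom ≫ t j)
    exact hinj i j (nonempty_iso_of_indecomposable_of_surjective (hP i) (f i) (hf i)
      (f j ∘ₗ p.toLinearEquiv.toLinearMap) ((hf j).comp p.toLinearEquiv.surjective))
  obtain ⟨k, ⟨e⟩⟩ := hsurj S hS
  obtain ⟨i, rfl⟩ := (Finite.injective_iff_surjective.1 hσi) k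
  obtain ⟨e'⟩ := hσ i
  let m : S ⟶ ModuleCat.of R R := (e ≪≫ e'.symm).hom ≫ t i ≫ (hr i).some.i
  have hm : Mono m := by
    have : IsSplitMono (hr i).some.i := ⟨⟨(hr i).some.r, (hr i).some.retract⟩⟩
    infer_instance
  exact ⟨m.hom, (ModuleCat.mono_iff_injective m).1 hm⟩

/-- A simple quotient of the cyclic module on `x` embeds into `R`, and the resulting map extends to
`N` because `R` is injective. -/
lemma exists_linearMap_apply_ne_zero {N : Type u} [AddCommGroup N] [Module R N] {x : N}
    (hx : x ≠ 0) : ∃ f : N →ₗ[R] R, f x ≠ 0 := by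
  let U := Submodule.span R {x}
  let y : U := ⟨x, Submodule.mem_span_singleton_self x⟩
  have : Nontrivial U := ⟨y, 0, fun h => hx (congrArg Subtype.val h)⟩
  obtain ⟨V, hV⟩ := IsCoatomic.exists_coatom (Submodule R U)
  have hy : y ∉ V := fun hy => hV.1 (eq_top_iff.2 fun z _ => by
    obtain ⟨r, hr⟩ := Submodule.mem_span_singleton.1 z.2
    have : z = r • y := Subtype.ext hr.symm
    exact this ▸ V.smul_mem r hy)
  obtain ⟨g, hg⟩ := exists_injective_of_isSimpleModule hs (ModuleCat.of R (U ⧸ V))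
    (isSimpleModule_iff_isCoatom.2 hV)
  obtain ⟨f, hf⟩ := hR.out U.subtype U.subtype_injective (g ∘ₗ V.mkQ)
  refine ⟨f, fun h0 => hy ?_⟩
  have h1 : g (V.mkQ y) = 0 := (hf y).symm.trans h0
  rw [map_eq_zero_iff g hg] at h1
  exact (Submodule.Quotient.mk_eq_zero V).1 h1

lemma isCogen_regular : IsCogen (ModuleCat.of R R) := by
  intro N hN
  -- As `N` is artinian, finitely many kernels already have the intersection of all of them, which
  -- is zero.
  obtain ⟨t, ht⟩ := Finset.exists_inf_le fun f : N →ₗ[R] R => LinearMap.ker f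
  let g : N →ₗ[R] (t → R) := LinearMap.pi fun f => f.1
  have hg : Function.Injective g := by
    rw [← LinearMap.ker_eq_bot, eq_bot_iff]
    intro x hx
    by_contra hx0
    obtain ⟨f, hf⟩ := exists_linearMap_apply_ne_zero hs (x := x) hx0
    refine hf (ht f (Submodule.mem_finsetInf.2 fun i hi => congrFun hx ⟨i, hi⟩))
  refine ⟨_, (LinearEquiv.funCongrLeft R R (Fintype.equivFin t).symm).toLinearMap ∘ₗ g, ?_⟩
  exact (LinearEquiv.funCongrLeft R R (Fintype.equivFin t).symm).injective.comp hg

/-- Over an artinian selfinjective ring, generators are cogenerators. -/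
lemma IsGen.isCogen {M : ModuleCat.{u} R} (hM : IsGen M) : IsCogen M := by
  intro N hN
  obtain ⟨n, p, hp⟩ := hM (ModuleCat.of R R) (inferInstanceAs (Module.Finite R R))
  obtain ⟨q, hq⟩ := Module.projective_lifting_property p (LinearMap.id (R := R) (M := R)) hp
  obtain ⟨k, f, hf⟩ := isCogen_regular hs N hN
  have hqi : Function.Injective q :=
    Function.LeftInverse.injective (g := p) fun x => LinearMap.congr_fun hq x
  refine ⟨_, (LinearEquiv.funCongrLeft R M finProdFinEquiv.symm).toLinearMap ∘ₗ
    (LinearEquiv.curry R M (Fin k) (Fin n)).symm.toLinearMap ∘ₗ q.compLeft (Fin k) ∘ₗ f, ?_⟩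
  refine (LinearEquiv.funCongrLeft R M finProdFinEquiv.symm).injective.comp
    ((LinearEquiv.curry R M (Fin k) (Fin n)).symm.injective.comp
      (Function.Injective.comp (g := q.compLeft (Fin k)) (fun a b h => ?_) hf))
  exact funext fun i => hqi (congrFun h i)

end SelfInjective

/-! ### Rigid modules built from syzygies. -/

section Rigid

variable {R : Type u} [Ring R]

lemma subsingleton_ext_pi_left {J : Type} [Fintype J] {X : J → ModuleCat.{u} R}
    {Y : ModuleCat.{u} R} {n : ℕ} (h : ∀ i, Subsingleton (Ext (X i) Y n)) :
    Subsingleton (Ext (ModuleCat.of R (∀ i, X i)) Y n) :=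
  subsingleton_ext_of_retract_left (ModuleCat.biproductIsoPi X).symm.retract
    (Ext.biproductAddEquiv (biproduct.isBilimit X) Y n).toEquiv.subsingleton

lemma subsingleton_ext_pi_right {J : Type} [Fintype J] {X : ModuleCat.{u} R}
    {Y : J → ModuleCat.{u} R} {n : ℕ} (h : ∀ i, Subsingleton (Ext X (Y i) n)) :
    Subsingleton (Ext X (ModuleCat.of R (∀ i, Y i)) n) :=
  subsingleton_ext_of_retract_right (ModuleCat.biproductIsoPi Y).symm.retract
    (Ext.addEquivBiproduct X (biproduct.isBilimit Y) n).toEquiv.subsingleton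

lemma isRigid_one_of_subsingleton_ext {N : ModuleCat.{u} R} (h : Subsingleton (Ext N N 1)) :
    IsRigid 1 N := by
  rintro X Y ⟨a, -, ⟨rX⟩⟩ ⟨b, -, ⟨rY⟩⟩ i hi hi'
  obtain rfl : i = 1 := by omega
  exact subsingleton_ext_of_retract_left rX (subsingleton_ext_of_retract_right rY
    (subsingleton_ext_pi_left (X := fun _ => N) fun _ =>
      subsingleton_ext_pi_right (Y := fun _ => N) fun _ => h))

/-- The inclusion of a factor as a summand of a product. -/
noncomputable def retractPi {J : Type} [DecidableEq J] (X : J → ModuleCat.{u} R) (j : J) :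
    Retract (X j) (ModuleCat.of R (∀ i, X i)) where
  i := ModuleCat.ofHom (LinearMap.single R (fun i => X i) j)
  r := ModuleCat.ofHom (LinearMap.proj j)
  retract := by ext x; simp

lemma exists_nonprojective_indecomposable_retract (N : ModuleCat.{u} R) [IsArtinian R N]
    [IsNoetherian R N] (hN : ¬ Projective N) :
    ∃ Y : ModuleCat.{u} R, Indecomposable Y ∧ Nonempty (Retract Y N) ∧ ¬ Projective Y := by
  refine exists_indecomposable_retract (fun Y => ¬ Projective Y)
    (fun X hX h => hX h.projective) (fun N X Y e hN => ?_) N hN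
  by_contra! hc
  have := hc.1
  have := hc.2
  exact hN (Projective.of_iso e.symm inferInstance)

section Syzygies

variable {M : ModuleCat.{u} R} {Ω : ℕ → ModuleCat.{u} R} (h0 : Ω 0 = M)
  (S : ℕ → ShortComplex (ModuleCat.{u} R)) (hS : ∀ i, (S i).ShortExact)
  (h1 : ∀ i, (S i).X₁ = Ω (i + 1)) (h3 : ∀ i, (S i).X₃ = Ω i)

include hS h1 h3

/-- The composite `Ωʲ⁺¹ → Y → Ωⁱ` extends to the projective middle term because the obstruction lies
in `Ext¹(Ωʲ, Ωⁱ)`. So the identity of `Y` factors through a projective. -/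
lemma projective_of_common_retract (hP : ∀ i, Projective (S i).X₂) {i j : ℕ}
    (h : Subsingleton (Ext (Ω j) (Ω i) 1)) {Y : ModuleCat.{u} R} (rj : Retract Y (Ω (j + 1)))
    (ri : Retract Y (Ω i)) : Projective Y := by
  have hj := hS j
  have e : (S j).X₁ ≅ Ω (j + 1) := eqToIso (h1 j)
  rw [← h3 j] at h
  obtain ⟨g, hg⟩ := ShortExact.exists_extension_of_subsingleton_ext hj h (e.hom ≫ rj.r ≫ ri.i)
  have := hP j
  refine Retract.projective (Y := (S j).X₂) ⟨rj.i ≫ e.inv ≫ (S j).f, g ≫ ri.r, ?_⟩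
  simp only [Category.assoc, reassoc_of% hg]
  simp [ri.retract, rj.retract]

include h0

lemma subsingleton_ext_syzygy_right (hI : ∀ i, Injective (S i).X₂) {X : ModuleCat.{u} R} {n : ℕ}
    (h : Subsingleton (Ext X M n)) (j : ℕ) : Subsingleton (Ext X (Ω j) (n + j)) := by
  induction j with
  | zero => exact h0 ▸ h
  | succ j ih =>
    rw [← h3] at ih
    rw [← h1]
    exact ShortExact.subsingleton_ext_succ_of_injective (hS j) (hI j) ih

lemma subsingleton_ext_syzygy_left (hP : ∀ i, Projective (S i).X₂) {Y : ModuleCat.{u} R} (i : ℕ) :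
    ∀ n : ℕ, Subsingleton (Ext M Y (n + 1 + i)) → Subsingleton (Ext (Ω i) Y (n + 1)) := by
  induction i with
  | zero => exact fun n h => h0 ▸ h
  | succ i ih =>
    intro n h
    have := ih (n + 1) (by convert h using 2; omega)
    rw [← h3] at this
    rw [← h1]
    exact ShortExact.subsingleton_ext_of_projective (hS i) (hP i) this

lemma subsingleton_ext_one_syzygy (hI : ∀ i, Injective (S i).X₂)
    (hP : ∀ i, Projective (S i).X₂) {r : ℕ} (h : ∀ k < r, Subsingleton (Ext M M (k + 1))) {i j : ℕ}
    (hij : j ≤ i) (hr : i - j < r) : Subsingleton (Ext (Ω i) (Ω j) 1) := by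
  refine subsingleton_ext_syzygy_left h0 S hS h1 h3 hP i 0 ?_
  have := subsingleton_ext_syzygy_right h0 S hS h1 h3 hI (h _ hr) j
  convert this using 2
  omega

/-- A projective `Ωⁱ⁺¹` would be injective, so its sequence would split and make `Ωⁱ` projective. -/
lemma not_projective_syzygy (hI : ∀ i, Projective (Ω i) → Injective (Ω i))
    (hP : ∀ i, Projective (S i).X₂) (hM : ¬ Projective M) (i : ℕ) : ¬ Projective (Ω i) := by
  induction i with
  | zero => exact h0 ▸ hM
  | succ i ih =>
    intro hp
    have hinj := hI _ hp
    rw [← h1] at hinj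
    have hs := (hS i).splittingOfInjective
    refine ih ?_
    rw [← h3]
    have := hP i
    exact Retract.projective ⟨hs.s, (S i).g, hs.s_g⟩

end Syzygies

variable [hR : Module.Injective R R]

lemma injective_pi_regular (n : ℕ) : Injective (ModuleCat.of R (Fin n → R)) :=
  Module.injective_object_of_injective_module R (Fin n → R)

lemma injective_of_projective_of_finite (P : ModuleCat.{u} R) [Module.Finite R P]
    [Projective P] : Injective P := by
  obtain ⟨n, f, hf⟩ := Module.Finite.exists_fin' R P
  obtain ⟨g, hg⟩ := Module.projective_lifting_property f (LinearMap.id (R := R) (M := P)) hf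
  have := injective_pi_regular (R := R) n
  exact injective_of_retract (Y := ModuleCat.of R (Fin n → R))
    ⟨ModuleCat.ofHom g, ModuleCat.ofHom f, by ext x; exact LinearMap.congr_fun hg x⟩

variable [IsArtinianRing R]

lemma exists_syzygy (M : ModuleCat.{u} R) [Module.Finite R M] :
    ∃ S : ShortComplex (ModuleCat.{u} R), S.ShortExact ∧ Projective S.X₂ ∧ Injective S.X₂ ∧
      Module.Finite R S.X₁ ∧ S.X₃ = M := by
  obtain ⟨n, f, hf⟩ := Module.Finite.exists_fin' R M
  let g : ModuleCat.of R (Fin n → R) ⟶ M := ModuleCat.ofHom f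
  refine ⟨ShortComplex.mk (ModuleCat.ofHom (LinearMap.ker f).subtype) g (by ext x; exact x.2), ?_, ?_, injective_pi_regular n, ?_, rfl⟩
  · have h1 : Mono (ModuleCat.ofHom (LinearMap.ker f).subtype) :=
      (ModuleCat.mono_iff_injective _).2 (LinearMap.ker f).subtype_injective
    have h2 : Epi g := (ModuleCat.epi_iff_surjective _).2 hf
    refine ⟨?_⟩
    rw [ShortComplex.moduleCat_exact_iff]
    exact fun x hx => ⟨⟨x, hx⟩, rfl⟩
  · exact ModuleCat.projective_of_categoryTheory_projective (P := ModuleCat.of R (Fin n → R))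
  · exact inferInstanceAs (Module.Finite R (LinearMap.ker f))

lemma exists_syzygies (M : ModuleCat.{u} R) [Module.Finite R M] :
    ∃ (Ω : ℕ → ModuleCat.{u} R) (S : ℕ → ShortComplex (ModuleCat.{u} R)), Ω 0 = M ∧
      (∀ i, Module.Finite R (Ω i)) ∧ (∀ i, (S i).ShortExact) ∧ (∀ i, Projective (S i).X₂) ∧
      (∀ i, Injective (S i).X₂) ∧ (∀ i, (S i).X₁ = Ω (i + 1)) ∧ ∀ i, (S i).X₃ = Ω i := by
  choose S hS hP hI hF h3 using fun N : {N : ModuleCat.{u} R // Module.Finite R N} =>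
    @exists_syzygy R _ _ _ N.1 N.2
  let Ω (n : ℕ) : {N : ModuleCat.{u} R // Module.Finite R N} :=
    Nat.rec ⟨M, inferInstance⟩ (fun _ N => ⟨(S N).X₁, hF N⟩) n
  exact ⟨fun i => (Ω i).1, fun i => S (Ω i), rfl, fun i => (Ω i).2, fun i => hS _, fun i => hP _,
    fun i => hI _, fun i => rfl, fun i => h3 _⟩

/-- If the first `r` self-extension groups of a module vanish, which is nonprojective if `0 < r`, then there is a rigid
module with at least `s + r` indecomposable summands, where `s` is the number of simple modules. -/
theorem exists_isRigid_of_subsingleton_ext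
    (hsymm : ∀ X Y : ModuleCat.{u} R, Module.Finite R X → Module.Finite R Y →
      (Nontrivial (Ext X Y 1) ↔ Nontrivial (Ext Y X 1)))
    (M : ModuleCat.{u} R) [Module.Finite R M] (r : ℕ)
    (hM : 0 < r → ¬ Projective M) (h : ∀ k < r, Subsingleton (Ext M M (k + 1))) :
    ∃ N : ModuleCat.{u} R, Module.Finite R N ∧ IsRigid 1 N ∧
      numIsoClasses (fun S : ModuleCat.{u} R => IsSimpleModule R S) + r ≤ moduleSize N := by
  obtain ⟨Ω, S, h0, hF, hS, hP, hI, h1, h3⟩ := exists_syzygies M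
  have hΩ (hr : 0 < r) (i : ℕ) : ¬ Projective (Ω i) := not_projective_syzygy h0 S hS h1 h3
    (fun i hi => have := hF i; injective_of_projective_of_finite (Ω i)) hP (hM hr) i
  have hext {i j : ℕ} (hij : j ≤ i) (hr : i - j < r) : Subsingleton (Ext (Ω i) (Ω j) 1) :=
    subsingleton_ext_one_syzygy h0 S hS h1 h3 hI hP h hij hr
  let Z : Option (Fin r) → ModuleCat.{u} R := fun o => o.elim (ModuleCat.of R R) fun i => Ω i
  have hZ (o) : Module.Finite R (Z o) := by
    cases o with
    | none => exact inferInstanceAs (Module.Finite R R)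
    | some i => exact hF i
  have hRP : Projective (ModuleCat.of R R) :=
    ModuleCat.projective_of_categoryTheory_projective (P := ModuleCat.of R R)
  have hRI : Injective (ModuleCat.of R R) := Module.injective_object_of_injective_module R R
  have hZZ (o o') : Subsingleton (Ext (Z o) (Z o') 1) := by
    rcases o with - | i
    · exact Ext.subsingleton_of_projective (ModuleCat.of R R) _ 0
    rcases o' with - | j
    · exact Ext.subsingleton_of_injective _ (ModuleCat.of R R) 0
    rcases le_total (j : ℕ) i with hij | hij
    · exact hext hij (by omega)
    -- Dimension shifting only covers `j ≤ i`; Ext-symmetry supplies the other order.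
    · rw [← not_nontrivial_iff_subsingleton, hsymm _ _ (hZ _) (hZ _),
        not_nontrivial_iff_subsingleton]
      exact hext hij (by omega)
  refine ⟨ModuleCat.of R (∀ o, Z o), inferInstanceAs (Module.Finite R (∀ o, Z o)),
    isRigid_one_of_subsingleton_ext (subsingleton_ext_pi_left fun o =>
      subsingleton_ext_pi_right fun o' => hZZ o o'), ?_⟩
  obtain ⟨ι, T, hcard, hT, hTinj, -⟩ :=
    exists_representatives (fun S : ModuleCat.{u} R => IsSimpleModule R S)
  have hRa : IsArtinian R (ModuleCat.of R R) := inferInstanceAs (IsArtinian R R)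
  have hRn : IsNoetherian R (ModuleCat.of R R) := inferInstanceAs (IsNoetherian R R)
  choose P hPi rP p hp using fun i => @exists_indecomposable_cover R _ _ (T i) (hT i)
  have hPa (i) : IsArtinian R (P i) := isArtinian_of_retract (rP i).some
  have hPn (i) : IsNoetherian R (P i) := isNoetherian_of_retract (rP i).some
  have hPp (i) : Projective (P i) := (rP i).some.projective
  choose Y hYi rY hYp using fun i : Fin r =>
    have := hF i
    exists_nonprojective_indecomposable_retract (Ω i) (hΩ i.pos i)
  rw [← hcard, ← ENat.card_eq_coe_fintype_card.trans (congrArg _ (Fintype.card_fin r)),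
    ← ENat.card_sum]
  have hlt {i j : Fin r} (hij : i < j) (e : Y i ≅ Y j) : False := by
    obtain ⟨k, hk⟩ : ∃ k, (j : ℕ) = k + 1 := ⟨j - 1, by omega⟩
    have rj := (rY j).some
    rw [hk] at rj
    exact hYp i (projective_of_common_retract S hS h1 h3 hP (i := i) (j := k)
      (hext (by omega) (by omega)) (Retract.trans e.retract rj) (rY i).some)
  refine card_le_numIsoClasses (Sum.elim P Y) ?_ ?_
  · rintro (i | i)
    · exact ⟨hPi i, ⟨(rP i).some.trans (retractPi Z none)⟩⟩
    · exact ⟨hYi i, ⟨(rY i).some.trans (retractPi Z (some i))⟩⟩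
  · rintro (i | i) (j | j) ⟨e⟩
    · have := hT i
      have := hT j
      dsimp at e
      exact congrArg _ (hTinj i j (nonempty_iso_of_indecomposable_of_surjective (hPi i) (p i) (hp i)
        (p j ∘ₗ e.toLinearEquiv.toLinearMap) ((hp j).comp e.toLinearEquiv.surjective)))
    · exact (hYp j (Projective.of_iso e (hPp i))).elim
    · exact (hYp i (Projective.of_iso e.symm (hPp j))).elim
    · rcases lt_trichotomy i j with hij | rfl | hij
      · exact (hlt hij e).elim
      · rfl
      · exact (hlt hij e.symm).elim

end Rigid

/-! ### Dominant dimension of endomorphism rings via Gabriel–Popescu. -/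

section DominantDimension

universe v w

/-- By naturality, an element killed by the unit is killed by every map to `B`, and these maps
separate the points of a projective module. -/
lemma mono_unit_app_of_projective {B : Type u} [Ring B] {C : Type v} [Category.{w} C]
    {F : ModuleCat.{u} B ⥤ C} {H : C ⥤ ModuleCat.{u} B} (adj : F ⊣ H)
    (hB : IsIso (adj.unit.app (ModuleCat.of B B))) (P : ModuleCat.{u} B) (hP : Projective P) :
    Mono (adj.unit.app P) := by
  rw [ModuleCat.mono_iff_injective, injective_iff_map_eq_zero]
  intro x hx
  have hdual (f : P ⟶ ModuleCat.of B B) : f.hom x = 0 := by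
    have h1 := congrArg (fun g => g.hom x) (adj.unit_naturality f)
    have h2 : (adj.unit.app (ModuleCat.of B B)).hom (f.hom x) = 0 := by
      refine h1.symm.trans ?_
      refine (congrArg (H.map (F.map f)).hom hx).trans (map_zero _)
    exact (map_eq_zero_iff _ ((ConcreteCategory.isIso_iff_bijective _).1 hB).1).1 h2
  obtain ⟨q, hq⟩ := Module.projective_lifting_property
    (Finsupp.linearCombination B (id : P → P)) LinearMap.id
    (Finsupp.linearCombination_id_surjective B P)
  have hqx : q x = 0 := by
    ext y
    exact hdual (ModuleCat.ofHom (Finsupp.lapply y ∘ₗ q))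
  exact (LinearMap.congr_fun hq x).symm.trans (by simp [hqx])

variable {R : Type u} [Ring R]

lemma IsGen.isSeparator {M : ModuleCat.{u} R} (hM : IsGen M) : IsSeparator M := by
  rw [isSeparator_def]
  intro X Y f g h
  obtain ⟨n, p, hp⟩ := hM (ModuleCat.of R R) (inferInstanceAs (Module.Finite R R))
  ext x
  obtain ⟨m, hm⟩ := hp (1 : R)
  let t : ModuleCat.of R (Fin n → M) ⟶ X :=
    ModuleCat.ofHom (LinearMap.toSpanSingleton R X x ∘ₗ p)
  have ht : t ≫ f = t ≫ g := by
    ext1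
    refine LinearMap.pi_ext' fun i => ?_
    have := h (ModuleCat.ofHom (LinearMap.single R (fun _ => M) i) ≫ t)
    exact congrArg ModuleCat.Hom.hom ((Category.assoc _ _ _).symm.trans
      (this.trans (Category.assoc _ _ _)))
  have htm : t.hom m = x := by
    change (p m : R) • x = x
    rw [hm, one_smul]
  have := congrArg (fun f => f.hom m) ht
  simpa [htm] using this

/-- The ring isomorphism between the two forms of the opposite endomorphism ring. -/
noncomputable def endOpRingEquiv (M : ModuleCat.{u} R) : (End M)ᵐᵒᵖ ≃+* (Module.End R M)ᵐᵒᵖ :=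
  RingEquiv.op M.endRingEquiv

/-- The regular module over `End(M)`, seen as a module over the categorical endomorphism ring, is
`Hom(M, M)`. -/
noncomputable def restrictScalarsEndIso (M : ModuleCat.{u} R) :
    (ModuleCat.restrictScalarsEquivalenceOfRingEquiv (endOpRingEquiv M)).functor.obj
      (ModuleCat.of (Module.End R M)ᵐᵒᵖ (Module.End R M)) ≅ (preadditiveCoyonedaObj M).obj M :=
  let e : (ModuleCat.restrictScalarsEquivalenceOfRingEquiv (endOpRingEquiv M)).functor.obj
      (ModuleCat.of (Module.End R M)ᵐᵒᵖ (Module.End R M)) ≃ₗ[(End M)ᵐᵒᵖ]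
        (preadditiveCoyonedaObj M).obj M :=
    { toFun := fun f => ModuleCat.ofHom f
      invFun := fun f => f.hom
      left_inv := fun _ => rfl
      right_inv := fun _ => rfl
      map_add' := fun _ _ => rfl
      map_smul' := fun _ _ => rfl }
  e.toModuleIso

/-- A ring is isomorphic to its opposite ring as a right module over itself. -/
def rightRegularEquiv (A : Type u) [Ring A] : A ≃ₗ[Aᵐᵒᵖ] Aᵐᵒᵖ :=
  { MulOpposite.opAddEquiv with
    map_smul' := fun _ _ => rfl }

lemma subsingleton_ext_of_injectiveResolution {M : ModuleCat.{u} R} (hM : IsGen M)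
    (I : InjectiveResolution (ModuleCat.of (Module.End R M)ᵐᵒᵖ (Module.End R M))) {n : ℕ}
    (hI : ∀ i < n, Projective (I.cocomplex.X i)) (i : ℕ) (hi : i + 3 ≤ n) :
    Subsingleton (Ext M M (i + 1)) := by
  let B := (Module.End R M)ᵐᵒᵖ
  let B₀ := ModuleCat.of (Module.End R M)ᵐᵒᵖ (Module.End R M)
  let E := ModuleCat.restrictScalarsEquivalenceOfRingEquiv (endOpRingEquiv M)
  have hsep := hM.isSeparator
  have := IsGrothendieckAbelian.GabrielPopescu.full M hsep
  have := IsGrothendieckAbelian.GabrielPopescu.preservesFiniteLimits M hsep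
  have : (preadditiveCoyonedaObj M).Faithful :=
    (isSeparator_iff_faithful_preadditiveCoyonedaObj M).1 hsep
  -- Gabriel–Popescu concerns modules over the categorical `(End M)ᵐᵒᵖ`; `E` transports it to
  -- `(Module.End R M)ᵐᵒᵖ`.
  let adj := E.toAdjunction.comp
    (IsGrothendieckAbelian.tensorObjPreadditiveCoyonedaObjAdjunction M)
  let e : B₀ ≅ (preadditiveCoyonedaObj M ⋙ E.inverse).obj M :=
    E.unitIso.app B₀ ≪≫ E.inverse.mapIso (restrictScalarsEndIso M)
  let eB : ModuleCat.of B B ≅ B₀ := (rightRegularEquiv (Module.End R M)).symm.toModuleIso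
  have hB : IsIso (adj.unit.app (ModuleCat.of B B)) := adj.isIso_unit_app_of_iso (eB ≪≫ e)
  have hP : Projective B₀ := Projective.of_iso eB
    (ModuleCat.projective_of_categoryTheory_projective (P := ModuleCat.of B B))
  have h := subsingleton_ext_of_projective_terms adj (mono_unit_app_of_projective adj hB) I hI i hi
  let eM : (E.functor ⋙ IsGrothendieckAbelian.tensorObj M).obj B₀ ≅ M :=
    (E.functor ⋙ IsGrothendieckAbelian.tensorObj M).mapIso e ≪≫ asIso (adj.counit.app M)
  exact subsingleton_ext_of_retract_left eM.symm.retract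
    (subsingleton_ext_of_retract_right eM.symm.retract h)

lemma domDim_end_le_phi {M : ModuleCat.{u} R} (hM : IsGen M) :
    domDim (ModuleCat.of (Module.End R M)ᵐᵒᵖ (Module.End R M)) ≤ phi M + 1 := by
  refine iSup₂_le ?_
  rintro (- | n) ⟨I, -, hI⟩
  · simp
  rw [Nat.cast_succ]
  refine add_le_add (le_iInf₂ ?_) le_rfl
  rintro r ⟨hr, hr'⟩
  by_contra! hlt
  have hlt' : r < n := by exact_mod_cast hlt
  obtain ⟨i, rfl⟩ : ∃ i, r = i + 1 := ⟨r - 1, by omega⟩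
  have hsub := subsingleton_ext_of_injectiveResolution hM I (n := n + 1)
    (fun i hi => have := hI i hi; ModuleCat.projective_of_categoryTheory_projective _) i (by omega)
  exact not_subsingleton _ hsub

end DominantDimension

/-! ### The numerical bounds. -/

section Bounds

variable (A : Type u) [Ring A]

lemma injective_op (h : Module.Injective Aᵐᵒᵖ A) : Module.Injective Aᵐᵒᵖ Aᵐᵒᵖ :=
  ((Module.Baer.of_injective h).of_equiv (rightRegularEquiv A)).injective

variable {A} [IsArtinianRing Aᵐᵒᵖ]

lemma numSimples_add_le_rigidBound (hA : IsOneExtsymmetric A) (M : ModuleCat.{u} Aᵐᵒᵖ)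
    [Module.Finite Aᵐᵒᵖ M] (r : ℕ) (hM : 0 < r → ¬ Projective M)
    (h : ∀ k < r, Subsingleton (Ext M M (k + 1))) : numSimples A + r ≤ rigidBound A 1 := by
  have := injective_op A hA.selfinjective
  obtain ⟨N, hN, hNr, hle⟩ := exists_isRigid_of_subsingleton_ext hA.ext_symm M r hM h
  exact hle.trans (le_iSup₂ (f := fun (M : ModuleCat.{u} Aᵐᵒᵖ)
    (_ : M ∈ {M : ModuleCat.{u} Aᵐᵒᵖ | Module.Finite Aᵐᵒᵖ M ∧ IsRigid 1 M}) => moduleSize M)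
    N ⟨hN, hNr⟩)

lemma delta_add_numSimples_le (hA : IsOneExtsymmetric A) {s : ℕ} (hs : numSimples A = s) :
    Delta A + s ≤ rigidBound A 1 + 1 := by
  have hs1 : (s : ℕ∞) ≤ rigidBound A 1 + 1 := by
    -- The zero module with `r = 0` gives `s ≤ o₁(A)`, so that the truncated subtraction below loses
    -- nothing.
    have := numSimples_add_le_rigidBound hA (ModuleCat.of Aᵐᵒᵖ PUnit) 0
      (fun h => absurd h (lt_irrefl 0)) (fun k hk => absurd hk (Nat.not_lt_zero k))
    rw [hs, Nat.cast_zero, add_zero] at this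
    exact this.trans le_self_add
  have hD : Delta A ≤ rigidBound A 1 + 1 - s := by
    refine iSup₂_le ?_
    rintro M ⟨hf, hp, -, -⟩
    -- Bounding every natural `n ≤ φ_M` also covers `φ_M = ∞`; for `n = r + 1` the groups `Extᵏ(M,
    -- M)` with `1 ≤ k ≤ r` vanish.
    refine ENat.forall_natCast_le_iff_le.1 fun n hn =>
      ENat.le_sub_of_add_le_right (ENat.natCast_ne_top s) ?_
    rcases n with - | r
    · simpa using hs1
    have := numSimples_add_le_rigidBound hA M r
      (fun _ h => hp (ModuleCat.projective_of_module_projective M)) (fun k hk => by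
        rw [← not_nontrivial_iff_subsingleton]
        intro hk'
        have h1 : phi M ≤ ((k + 1 : ℕ) : ℕ∞) := iInf₂_le (k + 1) ⟨by omega, hk'⟩
        have h2 : ((r + 1 : ℕ) : ℕ∞) ≤ ((k + 1 : ℕ) : ℕ∞) := hn.trans h1
        rw [ENat.natCast_le_natCast] at h2
        omega)
    rw [hs] at this
    calc ((r + 1 : ℕ) : ℕ∞) + s = s + r + 1 := by push_cast; ring
      _ ≤ _ := add_le_add this le_rfl
  calc Delta A + s ≤ rigidBound A 1 + 1 - s + s := add_le_add hD le_rfl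
    _ = _ := tsub_add_cancel_of_le hs1

lemma ringDomDim_end_le (hA : IsOneExtsymmetric A) {s : ℕ} (hs : numSimples A = s)
    (M : ModuleCat.{u} Aᵐᵒᵖ) (hf : Module.Finite Aᵐᵒᵖ M) (hM : IsGen M)
    (hp : ¬ Module.Projective Aᵐᵒᵖ M) :
    ringDomDim (Module.End Aᵐᵒᵖ M) ≤ Delta A + 1 := by
  have := injective_op A hA.selfinjective
  refine (domDim_end_le_phi hM).trans (add_le_add ?_ le_rfl)
  exact le_iSup₂ (f := fun (M : ModuleCat.{u} Aᵐᵒᵖ) (_ : M ∈ {M : ModuleCat.{u} Aᵐᵒᵖ |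
    Module.Finite Aᵐᵒᵖ M ∧ ¬ Module.Projective Aᵐᵒᵖ M ∧ IsGen M ∧ IsCogen M}) => phi M)
    M ⟨hf, hp, hM, hM.isCogen hs⟩

end Bounds

theorem mainTheorem4 (K : Type*) [Field K] (A : Type u) [Ring A] [Algebra K A]
    [FiniteDimensional K A] (hA : IsOneExtsymmetric A) (s : ℕ) (hs : numSimples A = s) :
    -- `Δ_A ≤ o₁(A) - s + 1`
    Delta A + s ≤ rigidBound A 1 + 1 ∧
    -- if `s ≥ 2`, then `Δ_A ≤ o₁(A) + s - 2`
    (2 ≤ s → Delta A + 2 ≤ rigidBound A 1 + s) ∧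
    -- bounds for `B = End_A(M)`, with `M` a nonprojective generator of `mod-A`
    ∀ M : ModuleCat.{u} Aᵐᵒᵖ, Module.Finite Aᵐᵒᵖ M → IsGen M → ¬ Module.Projective Aᵐᵒᵖ M →
      ringDomDim (Module.End Aᵐᵒᵖ M) ≤ Delta A + 1 ∧
      (Delta A + 1) + s ≤ rigidBound A 1 + 2 ∧
      (2 ≤ s → (Delta A + 1) + 1 ≤ rigidBound A 1 + s) := by
  have : IsArtinianRing Aᵐᵒᵖ := IsArtinianRing.of_finite K Aᵐᵒᵖ
  have h := delta_add_numSimples_le hA hs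
  have h2 (hs2 : 2 ≤ s) : Delta A + 2 ≤ rigidBound A 1 + s := by
    have h2s : (2 : ℕ∞) ≤ s := by exact_mod_cast hs2
    have h1s : (1 : ℕ∞) ≤ s := by exact_mod_cast (one_le_two.trans hs2)
    exact (add_le_add le_rfl h2s).trans (h.trans (add_le_add le_rfl h1s))
  refine ⟨h, h2, fun M hf hM hp => ⟨ringDomDim_end_le hA hs M hf hM hp, ?_, fun hs2 => ?_⟩⟩
  · calc Delta A + 1 + s = Delta A + s + 1 := by ring
      _ ≤ rigidBound A 1 + 1 + 1 := add_le_add h le_rfl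
      _ = _ := by rw [add_assoc, one_add_one_eq_two]
  · rw [add_assoc, one_add_one_eq_two]
    exact h2 hs2
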